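/- Let $\mathcal S$ be a stabilizer code on $n$ qubits, i.e. an Abelian subgroup of the $n$-qubit Pauli group that does not contain $-I$; its code space is the simultaneous $(+1)$-eigenspace of all elements of $\mathcal S$. Logical Pauli operators are the elements of the normalizer of $\mathcal S$ in the Pauli group; two of them are representatives of the same logical Pauli operator $\overline L$ if they differ by an element of $\mathcal S$ and a global phase, and $\overline L$ is non-trivial if it does not contain the identity. For a Pauli operator $P$, let $\operatorname{supp} P$ be the set of qubits on which $P$ acts non-trivially. Let $$d_\downarrow=\min_{\overline L\text{ non-trivial}}\ \min_{L\in\overline L}|\operatorname{supp}L|$$ be the min-distance of $\mathcal S$ (with $d_\downarrow=\infty$ if there are no non-trivial logical Pauli operators), and for a positive integer $M$ let $$\Omega_M(\mathcal S)=\max_{(\overline L_1,\dots,\overline L_M)}\ \min_{L_i\in\overline L_i}\Big|\bigcap_{i=1}^M\operatorname{supp}L_i\Big|,$$ where the maximum is over all $M$-tuples of logical Pauli operators. A logical gate is an $n$-qubit unitary that preserves the code space; it is transversal if it is a tensor product of $n$ single-qubit unitaries. The logical Clifford hierarchy is defined as follows: a logical gate is in the first level if it acts on the code space as a logical Pauli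 operator up to a global phase, and for $m\ge 1$ a logical gate $U$ is in the $(m+1)$-st level if $ULU^\dagger$ is in the $m$-th level for every logical Pauli operator $L$. If $M$ is a positive integer satisfying $\Omega_M(\mathcal S)<d_\downarrow$, then every transversal logical gate for $\mathcal S$ is in the $M$-th level of the logical Clifford hierarchy. -/

import Mathlib

/-! Qubit operators, stabilizer codes, distance, and the logical Clifford hierarchy. -/

/-- Labels of the computational basis of `n` qubits. -/
abbrev QBasis (n : ℕ) : Type := Fin n → Fin 2

/-- State vectors of `n` qubits. -/
abbrev QState (n : ℕ) : Type := QBasis n → ℂ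

/-- The unitary group on `n` qubits. -/
abbrev QUnitary (n : ℕ) : Type := Matrix.unitaryGroup (QBasis n) ℂ

/-- The four single-qubit Pauli labels. -/
inductive Pauli : Type
  | I | X | Y | Z

/-- The single-qubit Pauli matrices. -/
noncomputable def Pauli.mat : Pauli → Matrix (Fin 2) (Fin 2) ℂ
  | Pauli.I => 1
  | Pauli.X => !![0, 1; 1, 0]
  | Pauli.Y => !![0, -Complex.I; Complex.I, 0]
  | Pauli.Z => !![1, 0; 0, -1]

/-- The tensor product `A 0 ⊗ ⋯ ⊗ A (n - 1)` of single-qubit matrices. -/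
def tensorMat {n : ℕ} (A : Fin n → Matrix (Fin 2) (Fin 2) ℂ) :
    Matrix (QBasis n) (QBasis n) ℂ :=
  Matrix.of fun x y => ∏ j, A j (x j) (y j)

/-- The tensor product of single-qubit Pauli matrices given by a string of labels. -/
noncomputable def pauliString {n : ℕ} (P : Fin n → Pauli) : Matrix (QBasis n) (QBasis n) ℂ :=
  tensorMat fun j => (P j).mat

theorem tensorMat_mul {n : ℕ} (A B : Fin n → Matrix (Fin 2) (Fin 2) ℂ) :
    tensorMat A * tensorMat B = tensorMat fun j => A j * B j := by
  ext x y
  simp only [tensorMat, Matrix.mul_apply, Matrix.of_apply, Finset.prod_univ_sum,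
    Fintype.piFinset_univ, Finset.prod_mul_distrib]

theorem tensorMat_one {n : ℕ} :
    tensorMat (fun _ : Fin n => (1 : Matrix (Fin 2) (Fin 2) ℂ)) = 1 := by
  ext x y
  by_cases h : x = y
  · subst h
    simp [tensorMat]
  · obtain ⟨j, hj⟩ := Function.ne_iff.mp h
    rw [Matrix.one_apply_ne h]
    exact Finset.prod_eq_zero (Finset.mem_univ j) (Matrix.one_apply_ne hj)

theorem Pauli.mat_mul (p q : Pauli) :
    ∃ (k : ℕ) (r : Pauli), p.mat * q.mat = Complex.I ^ k • r.mat := by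
  have h3 : Complex.I ^ 3 = -Complex.I := by rw [pow_succ, Complex.I_sq]; ring
  cases p <;> cases q
  · exact ⟨0, .I, by simp [Pauli.mat]⟩
  · exact ⟨0, .X, by simp [Pauli.mat]⟩
  · exact ⟨0, .Y, by simp [Pauli.mat]⟩
  · exact ⟨0, .Z, by simp [Pauli.mat]⟩
  · exact ⟨0, .X, by simp [Pauli.mat]⟩
  · exact ⟨0, .I, by simp [Pauli.mat, Matrix.one_fin_two]⟩
  · exact ⟨1, .Z, by simp [Pauli.mat]⟩
  · exact ⟨3, .Y, by simp [Pauli.mat, h3]⟩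
  · exact ⟨0, .Y, by simp [Pauli.mat]⟩
  · exact ⟨3, .Z, by simp [Pauli.mat, h3]⟩
  · exact ⟨0, .I, by simp [Pauli.mat, Matrix.one_fin_two]⟩
  · exact ⟨1, .X, by simp [Pauli.mat]⟩
  · exact ⟨0, .Z, by simp [Pauli.mat]⟩
  · exact ⟨1, .Y, by simp [Pauli.mat]⟩
  · exact ⟨3, .X, by simp [Pauli.mat, h3]⟩
  · exact ⟨0, .I, by simp [Pauli.mat, Matrix.one_fin_two]⟩

theorem Pauli.mat_star (p : Pauli) : p.mat.conjTranspose = p.mat := by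
  cases p <;> ext i j <;> fin_cases i <;> fin_cases j <;> simp [Pauli.mat]

theorem pauliString_mul {n : ℕ} (P Q : Fin n → Pauli) :
    ∃ (k : ℕ) (R : Fin n → Pauli),
      pauliString P * pauliString Q = Complex.I ^ k • pauliString R := by
  choose k R h using fun j => Pauli.mat_mul (P j) (Q j)
  refine ⟨∑ j, k j, R, ?_⟩
  rw [pauliString, pauliString, tensorMat_mul]
  ext x y
  simp [tensorMat, pauliString, h, Finset.prod_mul_distrib, Finset.prod_pow_eq_pow_sum]

theorem pauliString_star {n : ℕ} (P : Fin n → Pauli) :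
    (pauliString P).conjTranspose = pauliString P := by
  ext x y
  simp only [pauliString, tensorMat, Matrix.conjTranspose_apply, Matrix.of_apply, star_prod]
  refine Finset.prod_congr rfl fun j _ => ?_
  rw [← Matrix.conjTranspose_apply, Pauli.mat_star]

/-- The `n`-qubit Pauli group: all `i ^ k • (P_1 ⊗ ⋯ ⊗ P_n)`, each `P_j` one of `I, X, Y, Z`. -/
noncomputable def pauliGroup (n : ℕ) : Subgroup (QUnitary n) where
  carrier := {g | ∃ (k : ℕ) (P : Fin n → Pauli),
    (g : Matrix (QBasis n) (QBasis n) ℂ) = Complex.I ^ k • pauliString P}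
  one_mem' := ⟨0, fun _ => .I, by
    simpa [pauliString, Pauli.mat] using (tensorMat_one (n := n)).symm⟩
  mul_mem' := by
    rintro a b ⟨k, P, ha⟩ ⟨l, Q, hb⟩
    obtain ⟨m, R, h⟩ := pauliString_mul P Q
    refine ⟨k + l + m, R, ?_⟩
    rw [Submonoid.coe_mul, ha, hb, Matrix.smul_mul, Matrix.mul_smul, h, smul_smul, smul_smul,
      pow_add, pow_add, mul_assoc]
  inv_mem' := by
    rintro a ⟨k, P, ha⟩
    refine ⟨3 * k, P, ?_⟩
    have h3 : Complex.I ^ 3 = -Complex.I := by rw [pow_succ, Complex.I_sq]; ring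
    rw [Matrix.UnitaryGroup.inv_val, ha, Matrix.star_eq_conjTranspose,
      Matrix.conjTranspose_smul, pauliString_star, pow_mul, h3]
    simp

/-- The support of a Pauli operator `i ^ k • (P_1 ⊗ ⋯ ⊗ P_n)`: the qubits `j` with `P_j ≠ I`
(the string `P` is determined by the operator). -/
noncomputable def pauliSupport {n : ℕ} (g : pauliGroup n) : Set (Fin n) :=
  {j | ∃ (k : ℕ) (P : Fin n → Pauli),
    ((g : QUnitary n) : Matrix (QBasis n) (QBasis n) ℂ) = Complex.I ^ k • pauliString P ∧
      P j ≠ Pauli.I}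

/-- A unitary is transversal if it is a tensor product of single-qubit unitaries. -/
def IsTransversal {n : ℕ} (U : QUnitary n) : Prop :=
  ∃ A : Fin n → Matrix.unitaryGroup (Fin 2) ℂ,
    (U : Matrix (QBasis n) (QBasis n) ℂ) =
      tensorMat fun j => (A j : Matrix (Fin 2) (Fin 2) ℂ)

/-- A stabilizer code on `n` qubits, given by its stabilizer group: an abelian subgroup of the
Pauli group that does not contain `-1`. -/
structure StabilizerCode (n : ℕ) where
  stab : Subgroup (pauliGroup n)
  comm : ∀ s ∈ stab, ∀ t ∈ stab, s * t = t * s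
  neg_one_notMem : ∀ s ∈ stab,
    ((s : QUnitary n) : Matrix (QBasis n) (QBasis n) ℂ) ≠ -1

namespace StabilizerCode

variable {n : ℕ} (S : StabilizerCode n)

/-- The code space: the states fixed by all stabilizers. -/
def codeSpace : Submodule ℂ (QState n) where
  carrier := {ψ | ∀ s ∈ S.stab,
    ((s : QUnitary n) : Matrix (QBasis n) (QBasis n) ℂ).mulVec ψ = ψ}
  add_mem' := fun ha hb s hs => by rw [Matrix.mulVec_add, ha s hs, hb s hs]
  zero_mem' := fun s _ => Matrix.mulVec_zero _
  smul_mem' := fun c ψ h s hs => by rw [Matrix.mulVec_smul, h s hs]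

/-- The group of logical Pauli operators: the normalizer of the stabilizer group in the Pauli
group. -/
noncomputable def logicalPaulis : Subgroup (pauliGroup n) := Subgroup.normalizer (S.stab : Set (pauliGroup n))

/-- `R` represents the same logical Pauli operator as `L`: they agree up to multiplication by a
stabilizer and a global phase. -/
def Equivalent (L R : pauliGroup n) : Prop :=
  ∃ c : ℂ, ∃ s ∈ S.stab,
    ((R : QUnitary n) : Matrix (QBasis n) (QBasis n) ℂ) =
      c • (((L * s : pauliGroup n) : QUnitary n) : Matrix (QBasis n) (QBasis n) ℂ)

/-- The non-trivial logical Pauli operators: those that are not a stabilizer up to a phase. -/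
def nontrivialLogicalPaulis : Set (pauliGroup n) :=
  {L | L ∈ S.logicalPaulis ∧ ¬ S.Equivalent 1 L}

/-- The distance of a logical Pauli operator: the smallest support size of a representative. -/
noncomputable def distance (L : pauliGroup n) : ℕ∞ :=
  ⨅ R ∈ {R : pauliGroup n | S.Equivalent L R}, (pauliSupport R).encard

/-- The min-distance: the minimal distance of a non-trivial logical Pauli operator (`⊤` if there
is none, that is, if the code has no logical qubits). -/
noncomputable def minDistance : ℕ∞ :=
  ⨅ L ∈ S.nontrivialLogicalPaulis, S.distance L

/-- The maximum over `M`-tuples of logical Pauli operators of the minimum over tuples of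
representatives of the size of the common support. -/
noncomputable def Omega (M : ℕ) : ℕ∞ :=
  ⨆ L : Fin M → S.logicalPaulis,
    ⨅ R ∈ {R : Fin M → pauliGroup n | ∀ i, S.Equivalent (L i) (R i)},
      (⋂ i, pauliSupport (R i)).encard

/-- A logical gate: a unitary that maps the code space into (hence, the dimension being finite,
onto) itself. -/
def IsLogicalGate (U : QUnitary n) : Prop :=
  ∀ ψ ∈ S.codeSpace, (U : Matrix (QBasis n) (QBasis n) ℂ).mulVec ψ ∈ S.codeSpace

/-- Levels of the logical Clifford hierarchy. Level `1`: the logical gates that act on the code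
space as a logical Pauli operator up to a global phase. Level `m + 1` for `m ≥ 1`: the logical
gates that conjugate every logical Pauli operator into level `m`. (Level `0`, not part of the
usual numbering: the logical gates that act on the code space as a global phase.) -/
def InCliffordLevel : ℕ → QUnitary n → Prop
  | 0, U => S.IsLogicalGate U ∧ ∃ c : ℂ,
      ∀ ψ ∈ S.codeSpace, (U : Matrix (QBasis n) (QBasis n) ℂ).mulVec ψ = c • ψ
  | 1, U => S.IsLogicalGate U ∧ ∃ c : ℂ, ∃ L ∈ S.logicalPaulis,
      ∀ ψ ∈ S.codeSpace, (U : Matrix (QBasis n) (QBasis n) ℂ).mulVec ψ =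
        c • ((L : QUnitary n) : Matrix (QBasis n) (QBasis n) ℂ).mulVec ψ
  | m + 2, U => S.IsLogicalGate U ∧
      ∀ L ∈ S.logicalPaulis, InCliffordLevel (m + 1) (U * (L : QUnitary n) * U⁻¹)

end StabilizerCode

/-!
For a transversal gate `U` and logical Pauli operators `L₁, …, L_M`, form the iterated group
commutator `K = ⁅⋯⁅⁅U, L₁⁆, L₂⁆⋯, L_M⁆`. It is a transversal logical gate supported on the common
support of the `L_i` (`IsTransversalOn.iteratedCommutator`). Its action on the code space, up to a
phase, does not change when the `L_i` are replaced by other representatives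
(`SameAction.iteratedCommutator`), so by `Ω_M < d` the common support may be assumed to have fewer
than `d` qubits. Expand `K` in Pauli strings supported there. A string outside the normalizer
anticommutes with a stabilizer and maps the code space to its orthogonal complement, so that only
the logical strings contribute (`StabilizerCode.mulVec_eq_sum_logical`); these are trivial by the
definition of the distance. Hence `K` is a phase on the code space
(`StabilizerCode.inCliffordLevel_zero_of_encard_lt`).

It remains to climb back from `K` to `U`, one commutator at a time: if `⁅V, L⁆` is in level `m` for
every logical Pauli operator `L`, then `V` is in level `m + 1`
(`StabilizerCode.inCliffordLevel_succ_of_commutator`). For `m ≥ 1` this holds since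
`V L V⁻¹ = ⁅V, L⁆ L`. For `m = 0`, the gate `V` commutes with each `L` up to a phase `χ L`; some
logical string `Q` has the same commutation phases
(`StabilizerCode.exists_pauliString_same_character`), so `Q V` commutes with all logical Pauli
operators on the code space, and is a scalar there because they act irreducibly
(`StabilizerCode.exists_scalar_of_commute`).
-/

open Matrix
open scoped ComplexOrder commutatorElement

/-! ### Pauli strings -/

instance : Fintype Pauli :=
  ⟨⟨([.I, .X, .Y, .Z] : List Pauli), by simp⟩, by rintro (_ | _ | _ | _) <;> simp⟩

theorem Pauli.sum_eq {α : Type*} [AddCommMonoid α] (f : Pauli → α) :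
    ∑ p, f p = f .I + (f .X + (f .Y + f .Z)) := by
  change ((([.I, .X, .Y, .Z] : List Pauli) : Multiset Pauli).map f).sum = _
  simp

theorem Pauli.mat_mul_self (p : Pauli) : p.mat * p.mat = 1 := by
  cases p <;> simp [Pauli.mat, Matrix.one_fin_two]

theorem Pauli.mat_comm (p q : Pauli) :
    ∃ e : ℂ, (e = 1 ∨ e = -1) ∧ p.mat * q.mat = e • (q.mat * p.mat) := by
  cases p <;> cases q <;>
    first
    | (refine ⟨1, Or.inl rfl, ?_⟩; simp [Pauli.mat]; done)
    | (refine ⟨-1, Or.inr rfl, ?_⟩; simp [Pauli.mat])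

theorem Pauli.exists_anticomm {p : Pauli} (hp : p ≠ .I) :
    ∃ q : Pauli, p.mat * q.mat = (-1 : ℂ) • (q.mat * p.mat) := by
  cases p
  · exact absurd rfl hp
  · exact ⟨.Z, by simp [Pauli.mat]⟩
  · exact ⟨.Z, by simp [Pauli.mat]⟩
  · exact ⟨.X, by simp [Pauli.mat]⟩

theorem Pauli.exists_sum_smul_mat (A : Matrix (Fin 2) (Fin 2) ℂ) :
    ∃ a : Pauli → ℂ, A = ∑ p, a p • p.mat := by
  refine ⟨fun p => match p with
    | .I => (A 0 0 + A 1 1) / 2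
    | .X => (A 0 1 + A 1 0) / 2
    | .Y => Complex.I * (A 0 1 - A 1 0) / 2
    | .Z => (A 0 0 - A 1 1) / 2, ?_⟩
  rw [Pauli.sum_eq]
  ext i j
  fin_cases i <;> fin_cases j <;> simp [Pauli.mat] <;> ring_nf <;> simp <;> ring

section Strings

variable {n : ℕ}

theorem tensorMat_smul (e : Fin n → ℂ) (A : Fin n → Matrix (Fin 2) (Fin 2) ℂ) :
    tensorMat (fun j => e j • A j) = (∏ j, e j) • tensorMat A := by
  ext x y
  simp [tensorMat, Finset.prod_mul_distrib]

theorem tensorMat_sum_smul (a : Fin n → Pauli → ℂ) :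
    tensorMat (fun j => ∑ p, a j p • p.mat) =
      ∑ P : Fin n → Pauli, (∏ j, a j (P j)) • pauliString P := by
  ext x y
  simp only [tensorMat, pauliString, Matrix.of_apply, Matrix.sum_apply, Matrix.smul_apply,
    Finset.prod_univ_sum, Fintype.piFinset_univ, smul_eq_mul, Finset.prod_mul_distrib]

theorem pauliString_mul_self (P : Fin n → Pauli) : pauliString P * pauliString P = 1 := by
  simp only [pauliString, tensorMat_mul, Pauli.mat_mul_self, tensorMat_one]

theorem pauliString_comm (P Q : Fin n → Pauli) :
    ∃ e : ℂ, (e = 1 ∨ e = -1) ∧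
      pauliString P * pauliString Q = e • (pauliString Q * pauliString P) := by
  choose e he h using fun j => Pauli.mat_comm (P j) (Q j)
  refine ⟨∏ j, e j, ?_, ?_⟩
  · exact Finset.prod_induction e (fun z => z = 1 ∨ z = -1)
      (by rintro a b (rfl | rfl) (rfl | rfl) <;> simp) (Or.inl rfl) fun j _ => he j
  · simp only [pauliString, tensorMat_mul, h, tensorMat_smul]

/-- An operator determines which tensor factors of its Pauli string are the identity, as a string
with a non-identity factor at `j` anticommutes with some Pauli matrix on qubit `j`. -/
theorem pauliString_eq_smul_imp {P Q : Fin n → Pauli} {c : ℂ}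
    (h : pauliString P = c • pauliString Q) {j : Fin n} (hj : P j = .I) : Q j = .I := by
  by_contra hQ
  obtain ⟨q, hq⟩ := Pauli.exists_anticomm hQ
  let R : Fin n → Pauli := fun k => if k = j then q else .I
  have hP : pauliString P * pauliString R = pauliString R * pauliString P := by
    simp only [pauliString, tensorMat_mul]
    congr 1
    ext1 k
    by_cases hk : k = j
    · subst hk; simp [hj, Pauli.mat]
    · simp [R, hk, Pauli.mat]
  have hQR : pauliString Q * pauliString R = (-1 : ℂ) • (pauliString R * pauliString Q) := by
    have : ∀ k, (Q k).mat * (R k).mat =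
        (if k = j then (-1 : ℂ) else 1) • ((R k).mat * (Q k).mat) := by
      intro k
      by_cases hk : k = j
      · subst hk; simpa [R] using hq
      · simp [R, hk, Pauli.mat]
    simp only [pauliString, tensorMat_mul, this, tensorMat_smul]
    simp
  have h1 : pauliString P * pauliString R = -(pauliString P * pauliString R) := by
    conv_lhs => rw [h, Matrix.smul_mul, hQR]
    rw [hP, h, Matrix.mul_smul, smul_comm]
    simp
  have h2 : pauliString P * pauliString R = 0 := by
    ext x y
    exact self_eq_neg.mp (congrFun (congrFun h1 x) y)
  have h3 : (1 : Matrix (QBasis n) (QBasis n) ℂ) = 0 := by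
    calc (1 : Matrix (QBasis n) (QBasis n) ℂ)
        = pauliString P * (pauliString P * pauliString R) * pauliString R := by
          rw [← mul_assoc, pauliString_mul_self, one_mul, pauliString_mul_self]
      _ = 0 := by rw [h2, mul_zero, zero_mul]
  exact one_ne_zero h3

theorem exists_sum_smul_pauliString (E : Matrix (QBasis n) (QBasis n) ℂ) :
    ∃ c : (Fin n → Pauli) → ℂ, E = ∑ P, c P • pauliString P := by
  have key : ∀ x y : QBasis n, ∃ c : (Fin n → Pauli) → ℂ,
      Matrix.single x y (1 : ℂ) = ∑ P, c P • pauliString P := by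
    intro x y
    choose a ha using fun j => Pauli.exists_sum_smul_mat (Matrix.single (x j) (y j) (1 : ℂ))
    refine ⟨fun P => ∏ j, a j (P j), ?_⟩
    rw [← tensorMat_sum_smul]
    simp only [← ha]
    ext u v
    simp only [tensorMat, Matrix.of_apply, Matrix.single_apply, Finset.prod_ite_zero,
      Finset.prod_const_one]
    congr 1
    simp [funext_iff, forall_and]
  choose c hc using key
  refine ⟨fun P => ∑ x, ∑ y, E x y * c x y P, ?_⟩
  conv_lhs => rw [Matrix.matrix_eq_sum_single E]
  have h : ∀ x y, Matrix.single x y (E x y) = ∑ P, (E x y * c x y P) • pauliString P := by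
    intro x y
    rw [← mul_one (E x y), ← smul_eq_mul, ← Matrix.smul_single, hc, Finset.smul_sum]
    simp [smul_smul]
  simp only [h, Finset.sum_smul]
  rw [Finset.sum_comm]
  refine (Finset.sum_congr rfl fun y _ => Finset.sum_comm).trans ?_
  rw [Finset.sum_comm]
  exact Finset.sum_congr rfl fun P _ => Finset.sum_comm

/-- A Pauli string as an element of the Pauli group. -/
noncomputable def pauliElem (P : Fin n → Pauli) : pauliGroup n :=
  ⟨⟨pauliString P, by
    rw [Matrix.mem_unitaryGroup_iff, Matrix.star_eq_conjTranspose, pauliString_star,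
      pauliString_mul_self]⟩, 0, P, by simp⟩

theorem coe_pauliElem (P : Fin n → Pauli) :
    ((pauliElem P : QUnitary n) : Matrix (QBasis n) (QBasis n) ℂ) = pauliString P := rfl

theorem pauliSupport_pauliElem_subset {P : Fin n → Pauli} {T : Set (Fin n)}
    (h : ∀ j ∉ T, P j = .I) : pauliSupport (pauliElem P) ⊆ T := by
  rintro j ⟨k, Q, hQ, hj⟩
  by_contra hT
  exact hj (pauliString_eq_smul_imp hQ (h j hT))

theorem pauliGroup_comm (g h : pauliGroup n) :
    ∃ e : ℂ, (e = 1 ∨ e = -1) ∧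
      ((g : QUnitary n) : Matrix (QBasis n) (QBasis n) ℂ) * (h : QUnitary n) =
        e • (((h : QUnitary n) : Matrix (QBasis n) (QBasis n) ℂ) * (g : QUnitary n)) := by
  obtain ⟨k, P, hP⟩ := g.2
  obtain ⟨l, Q, hQ⟩ := h.2
  obtain ⟨e, he, hc⟩ := pauliString_comm P Q
  refine ⟨e, he, ?_⟩
  rw [hP, hQ]
  simp only [Matrix.smul_mul, Matrix.mul_smul, hc, smul_smul]
  congr 1
  ring

end Strings

/-! ### The code space and the logical Pauli operators -/

namespace StabilizerCode

variable {n : ℕ} (S : StabilizerCode n)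

/-- Normalizing the stabilizer group amounts to centralizing it, because Pauli operators commute up
to a sign and `-1` is not a stabilizer. -/
theorem mem_logicalPaulis_iff (g : pauliGroup n) :
    g ∈ S.logicalPaulis ↔ ∀ s ∈ S.stab, g * s = s * g := by
  constructor
  · intro hg s hs
    have hgs : g * s * g⁻¹ ∈ S.stab := (Subgroup.mem_normalizer_iff.mp hg s).mp hs
    obtain ⟨e, rfl | rfl, he⟩ := pauliGroup_comm g s
    · exact Subtype.ext (Subtype.ext (by simpa using he))
    · refine absurd ?_ (S.neg_one_notMem _ (S.stab.mul_mem hgs (S.stab.inv_mem hs)))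
      have h1 : (((g * s * g⁻¹ * s⁻¹ : pauliGroup n) : QUnitary n) :
          Matrix (QBasis n) (QBasis n) ℂ) =
          ((g : QUnitary n) : Matrix (QBasis n) (QBasis n) ℂ) * (s : QUnitary n) *
            ((s * g : pauliGroup n)⁻¹ : QUnitary n) := by
        simp [mul_assoc]
      have h2 : ((s : QUnitary n) : Matrix (QBasis n) (QBasis n) ℂ) * (g : QUnitary n) =
          ((s * g : pauliGroup n) : QUnitary n) := rfl
      rw [h1, he, h2, Matrix.smul_mul]
      have h3 : ((((s * g : pauliGroup n) : QUnitary n)) : Matrix (QBasis n) (QBasis n) ℂ) *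
          ((s * g : pauliGroup n)⁻¹ : QUnitary n) = 1 :=
        congrArg Subtype.val (mul_inv_cancel ((s * g : pauliGroup n) : QUnitary n))
      rw [h3, neg_one_smul]
  · intro h
    refine Subgroup.mem_normalizer_iff.mpr fun s => ⟨fun hs => ?_, fun hs => ?_⟩
    · rwa [h s hs, mul_inv_cancel_right]
    · have := h _ hs
      have hc : s = g * s * g⁻¹ := by
        have h' : g * (g * s * g⁻¹) = g * s := by rw [this]; group
        exact (mul_left_cancel h').symm
      rwa [hc]

theorem exists_anticomm_of_notMem {g : pauliGroup n} (hg : g ∉ S.logicalPaulis) :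
    ∃ s ∈ S.stab, ((g : QUnitary n) : Matrix (QBasis n) (QBasis n) ℂ) * (s : QUnitary n) =
      -(((s : QUnitary n) : Matrix (QBasis n) (QBasis n) ℂ) * (g : QUnitary n)) := by
  rw [mem_logicalPaulis_iff] at hg
  push Not at hg
  obtain ⟨s, hs, h⟩ := hg
  obtain ⟨e, rfl | rfl, he⟩ := pauliGroup_comm g s
  · exact absurd (Subtype.ext (Subtype.ext (by simpa using he))) h
  · exact ⟨s, hs, by simpa using he⟩

theorem isLogicalGate_of_mem {L : pauliGroup n} (hL : L ∈ S.logicalPaulis) :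
    S.IsLogicalGate (L : QUnitary n) := by
  intro ψ hψ s hs
  have h := congrArg (fun g : pauliGroup n =>
    ((g : QUnitary n) : Matrix (QBasis n) (QBasis n) ℂ)) ((S.mem_logicalPaulis_iff L).mp hL s hs)
  simp only [Subgroup.coe_mul, Submonoid.coe_mul] at h
  rw [Matrix.mulVec_mulVec, ← h, ← Matrix.mulVec_mulVec, hψ s hs]

/-- A Pauli operator that is not logical maps the code space to its orthogonal complement. -/
theorem star_dotProduct_eq_zero {g : pauliGroup n} (hg : g ∉ S.logicalPaulis)
    {φ ψ : QState n} (hφ : φ ∈ S.codeSpace) (hψ : ψ ∈ S.codeSpace) :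
    star φ ⬝ᵥ ((g : QUnitary n) : Matrix (QBasis n) (QBasis n) ℂ) *ᵥ ψ = 0 := by
  obtain ⟨s, hs, h⟩ := S.exists_anticomm_of_notMem hg
  have hv : star φ ᵥ* ((s : QUnitary n) : Matrix (QBasis n) (QBasis n) ℂ) = star φ := by
    have h1 := hφ s⁻¹ (S.stab.inv_mem hs)
    rw [Subgroup.coe_inv, Matrix.UnitaryGroup.inv_val, Matrix.star_eq_conjTranspose] at h1
    conv_rhs => rw [← h1]
    rw [Matrix.star_mulVec, Matrix.conjTranspose_conjTranspose]
  refine self_eq_neg.mp ?_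
  conv_lhs => rw [← hψ s hs, Matrix.mulVec_mulVec, h, Matrix.neg_mulVec, dotProduct_neg,
    ← Matrix.mulVec_mulVec, Matrix.dotProduct_mulVec, hv]

open Classical in
/-- On the code space, an operator preserving it equals the logical part of its Pauli expansion:
the remaining terms are orthogonal to the code space, as in the Knill–Laflamme conditions. -/
theorem mulVec_eq_sum_logical {E : Matrix (QBasis n) (QBasis n) ℂ}
    (hE : ∀ ψ ∈ S.codeSpace, E *ᵥ ψ ∈ S.codeSpace) {c : (Fin n → Pauli) → ℂ}
    (hc : E = ∑ P, c P • pauliString P) {ψ : QState n} (hψ : ψ ∈ S.codeSpace) :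
    E *ᵥ ψ = ∑ P, (if pauliElem P ∈ S.logicalPaulis then c P else 0) • (pauliString P *ᵥ ψ) := by
  set χ := ∑ P, (if pauliElem P ∈ S.logicalPaulis then c P else 0) • (pauliString P *ᵥ ψ) with hχ
  have hmem : χ ∈ S.codeSpace := by
    refine Submodule.sum_mem _ fun P _ => ?_
    split_ifs with h
    · exact Submodule.smul_mem _ _ (S.isLogicalGate_of_mem h ψ hψ)
    · simp
  have hdiff : E *ᵥ ψ - χ =
      ∑ P, (if pauliElem P ∈ S.logicalPaulis then 0 else c P) • (pauliString P *ᵥ ψ) := by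
    rw [hc, hχ, Matrix.sum_mulVec, ← Finset.sum_sub_distrib]
    refine Finset.sum_congr rfl fun P _ => ?_
    split_ifs <;> simp [Matrix.smul_mulVec]
  have horth : ∀ φ ∈ S.codeSpace, star φ ⬝ᵥ (E *ᵥ ψ - χ) = 0 := by
    intro φ hφ
    rw [hdiff, dotProduct_sum]
    refine Finset.sum_eq_zero fun P _ => ?_
    split_ifs with h
    · simp
    · rw [dotProduct_smul, ← coe_pauliElem, S.star_dotProduct_eq_zero h hφ hψ, smul_zero]
  exact sub_eq_zero.mp (dotProduct_star_self_eq_zero.mp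
    (horth _ (Submodule.sub_mem _ (hE ψ hψ) hmem)))

/-- The logical Pauli operators act irreducibly: an operator that commutes with all of them on the
code space commutes there with every operator preserving it, and commuting with the rank-one
operators `|φ⟩⟨ψ|` makes it a scalar. -/
theorem exists_scalar_of_commute {T : Matrix (QBasis n) (QBasis n) ℂ}
    (hcomm : ∀ P, pauliElem P ∈ S.logicalPaulis → ∀ ψ ∈ S.codeSpace,
      T *ᵥ (pauliString P *ᵥ ψ) = pauliString P *ᵥ (T *ᵥ ψ))
    (hT : ∀ ψ ∈ S.codeSpace, T *ᵥ ψ ∈ S.codeSpace) :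
    ∃ c : ℂ, ∀ ψ ∈ S.codeSpace, T *ᵥ ψ = c • ψ := by
  classical
  by_cases h0 : ∀ ψ ∈ S.codeSpace, ψ = 0
  · exact ⟨0, fun ψ hψ => by simp [h0 ψ hψ]⟩
  push Not at h0
  obtain ⟨ψ, hψ, hne⟩ := h0
  have hn : star ψ ⬝ᵥ ψ ≠ 0 := fun h => hne (dotProduct_star_self_eq_zero.mp h)
  refine ⟨(star ψ ⬝ᵥ T *ᵥ ψ) / (star ψ ⬝ᵥ ψ), fun φ hφ => ?_⟩
  have happ : ∀ v, Matrix.vecMulVec φ (star ψ) *ᵥ v = (star ψ ⬝ᵥ v) • φ := fun v => by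
    rw [Matrix.vecMulVec_mulVec]; simp
  obtain ⟨c, hc⟩ := exists_sum_smul_pauliString (Matrix.vecMulVec φ (star ψ))
  have hE : ∀ v ∈ S.codeSpace, Matrix.vecMulVec φ (star ψ) *ᵥ v ∈ S.codeSpace := fun v _ => by
    rw [happ]; exact Submodule.smul_mem _ _ hφ
  have key : T *ᵥ (Matrix.vecMulVec φ (star ψ) *ᵥ ψ) =
      Matrix.vecMulVec φ (star ψ) *ᵥ (T *ᵥ ψ) := by
    rw [S.mulVec_eq_sum_logical hE hc hψ, S.mulVec_eq_sum_logical hE hc (hT ψ hψ),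
      Matrix.mulVec_sum]
    refine Finset.sum_congr rfl fun P _ => ?_
    split_ifs with h
    · rw [Matrix.mulVec_smul, hcomm P h ψ hψ]
    · simp
  rw [happ, happ, Matrix.mulVec_smul] at key
  rw [div_eq_inv_mul, mul_smul, ← key, inv_smul_smul₀ hn]

/-! ### Logical gates up to a phase on the code space -/

variable {S}

theorem IsLogicalGate.mul {U V : QUnitary n} (hU : S.IsLogicalGate U) (hV : S.IsLogicalGate V) :
    S.IsLogicalGate (U * V) := fun ψ hψ => by
  rw [Submonoid.coe_mul, ← Matrix.mulVec_mulVec]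
  exact hU _ (hV ψ hψ)

theorem inv_mulVec_mulVec (U : QUnitary n) (ψ : QState n) :
    ((U⁻¹ : QUnitary n) : Matrix (QBasis n) (QBasis n) ℂ) *ᵥ
      ((U : Matrix (QBasis n) (QBasis n) ℂ) *ᵥ ψ) = ψ := by
  rw [Matrix.mulVec_mulVec, ← Submonoid.coe_mul, inv_mul_cancel]
  simp

theorem mulVec_inv_mulVec (U : QUnitary n) (ψ : QState n) :
    (U : Matrix (QBasis n) (QBasis n) ℂ) *ᵥ
      (((U⁻¹ : QUnitary n) : Matrix (QBasis n) (QBasis n) ℂ) *ᵥ ψ) = ψ := by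
  simpa only [inv_inv] using inv_mulVec_mulVec U⁻¹ ψ

theorem mulVec_ne_zero (U : QUnitary n) {ψ : QState n} (h : ψ ≠ 0) :
    (U : Matrix (QBasis n) (QBasis n) ℂ) *ᵥ ψ ≠ 0 := fun h0 => h <| by
  rw [← inv_mulVec_mulVec U ψ, h0, Matrix.mulVec_zero]

theorem IsLogicalGate.inv {U : QUnitary n} (hU : S.IsLogicalGate U) :
    S.IsLogicalGate U⁻¹ := by
  intro ψ hψ
  -- a unitary preserving the finite-dimensional code space is onto it
  let f : S.codeSpace →ₗ[ℂ] S.codeSpace := 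
    (Matrix.mulVecLin (U : Matrix (QBasis n) (QBasis n) ℂ)).restrict hU
  have hinj : Function.Injective f := by
    intro a b hab
    have h1 : (U : Matrix (QBasis n) (QBasis n) ℂ) *ᵥ (a : QState n) =
      (U : Matrix (QBasis n) (QBasis n) ℂ) *ᵥ (b : QState n) := congrArg Subtype.val hab
    apply Subtype.ext
    rw [← inv_mulVec_mulVec U a, h1, inv_mulVec_mulVec]
  obtain ⟨φ, hφ⟩ :=
    LinearMap.injective_iff_surjective (f := f) |>.mp hinj ⟨ψ, hψ⟩
  have h2 : (U : Matrix (QBasis n) (QBasis n) ℂ) *ᵥ (φ : QState n) = ψ := congrArg Subtype.val hφ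
  rw [← h2, inv_mulVec_mulVec]
  exact φ.2

theorem IsLogicalGate.commutator {U V : QUnitary n} (hU : S.IsLogicalGate U)
    (hV : S.IsLogicalGate V) : S.IsLogicalGate ⁅U, V⁆ :=
  ((hU.mul hV).mul hU.inv).mul hV.inv

variable (S) in
/-- `U` and `V` are logical gates with the same action on the code space up to a non-zero
scalar. -/
def SameAction (U V : QUnitary n) : Prop :=
  S.IsLogicalGate U ∧ S.IsLogicalGate V ∧ ∃ c : ℂ, c ≠ 0 ∧ ∀ ψ ∈ S.codeSpace,
    (U : Matrix (QBasis n) (QBasis n) ℂ) *ᵥ ψ = c • ((V : Matrix (QBasis n) (QBasis n) ℂ) *ᵥ ψ)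

theorem SameAction.refl {U : QUnitary n} (hU : S.IsLogicalGate U) : S.SameAction U U :=
  ⟨hU, hU, 1, one_ne_zero, by simp⟩

theorem SameAction.mul {U U' V V' : QUnitary n} (hU : S.SameAction U U')
    (hV : S.SameAction V V') : S.SameAction (U * V) (U' * V') := by
  obtain ⟨h1, h2, c, hc, h⟩ := hU
  obtain ⟨h3, h4, d, hd, h'⟩ := hV
  refine ⟨h1.mul h3, h2.mul h4, d * c, mul_ne_zero hd hc, fun ψ hψ => ?_⟩
  rw [Submonoid.coe_mul, Submonoid.coe_mul, ← Matrix.mulVec_mulVec, ← Matrix.mulVec_mulVec,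
    h' ψ hψ, Matrix.mulVec_smul, h _ (h4 ψ hψ), smul_smul]

theorem SameAction.inv {U V : QUnitary n} (h : S.SameAction U V) : S.SameAction U⁻¹ V⁻¹ := by
  obtain ⟨h1, h2, c, hc, h⟩ := h
  refine ⟨h1.inv, h2.inv, c⁻¹, inv_ne_zero hc, fun ψ hψ => ?_⟩
  have := h _ (h2.inv ψ hψ)
  rw [mulVec_inv_mulVec] at this
  conv_lhs => rw [← inv_smul_smul₀ hc ψ, ← this, Matrix.mulVec_smul, inv_mulVec_mulVec]

theorem SameAction.commutator {U U' V V' : QUnitary n} (hU : S.SameAction U U')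
    (hV : S.SameAction V V') : S.SameAction ⁅U, V⁆ ⁅U', V'⁆ :=
  ((hU.mul hV).mul hU.inv).mul hV.inv

theorem Equivalent.sameAction {L R : pauliGroup n} (h : S.Equivalent L R)
    (hL : L ∈ S.logicalPaulis) : S.SameAction (L : QUnitary n) (R : QUnitary n) := by
  obtain ⟨c, s, hs, hR⟩ := h
  have hc : c ≠ 0 := by
    rintro rfl
    have h1 : ((R : QUnitary n) : Matrix (QBasis n) (QBasis n) ℂ) *
        ((R : QUnitary n)⁻¹ : QUnitary n) = 1 :=
      congrArg Subtype.val (mul_inv_cancel (R : QUnitary n))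
    rw [hR, zero_smul, zero_mul] at h1
    exact zero_ne_one h1
  have hact : ∀ ψ ∈ S.codeSpace, ((R : QUnitary n) : Matrix (QBasis n) (QBasis n) ℂ) *ᵥ ψ =
      c • (((L : QUnitary n) : Matrix (QBasis n) (QBasis n) ℂ) *ᵥ ψ) := by
    intro ψ hψ
    rw [hR, Matrix.smul_mulVec, Subgroup.coe_mul, Submonoid.coe_mul, ← Matrix.mulVec_mulVec,
      hψ s hs]
  refine ⟨S.isLogicalGate_of_mem hL, fun ψ hψ => ?_, c⁻¹, inv_ne_zero hc, fun ψ hψ => ?_⟩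
  · rw [hact ψ hψ]
    exact Submodule.smul_mem _ _ (S.isLogicalGate_of_mem hL ψ hψ)
  · rw [hact ψ hψ, inv_smul_smul₀ hc]

theorem SameAction.inCliffordLevel_zero {U V : QUnitary n} (h : S.SameAction U V)
    (hV : S.InCliffordLevel 0 V) : S.InCliffordLevel 0 U := by
  obtain ⟨h1, h2, c, hc, h⟩ := h
  obtain ⟨-, d, hd⟩ := hV
  exact ⟨h1, c * d, fun ψ hψ => by rw [h ψ hψ, hd ψ hψ, smul_smul]⟩

/-! ### Climbing the hierarchy with commutators -/

theorem InCliffordLevel.isLogicalGate {m : ℕ} {U : QUnitary n} (h : S.InCliffordLevel m U) :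
    S.IsLogicalGate U := by
  match m, h with
  | 0, h => exact h.1
  | 1, h => exact h.1
  | _ + 2, h => exact h.1

theorem InCliffordLevel.mul_logicalPauli {m : ℕ} {U : QUnitary n} {L : pauliGroup n}
    (h : S.InCliffordLevel (m + 1) U) (hL : L ∈ S.logicalPaulis) :
    S.InCliffordLevel (m + 1) (U * (L : QUnitary n)) := by
  have hg := h.isLogicalGate.mul (S.isLogicalGate_of_mem hL)
  match m, h with
  | 0, ⟨_, c, R, hR, h⟩ =>
    refine ⟨hg, c, R * L, mul_mem hR hL, fun ψ hψ => ?_⟩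
    rw [Submonoid.coe_mul, ← Matrix.mulVec_mulVec, h _ (S.isLogicalGate_of_mem hL ψ hψ),
      Matrix.mulVec_mulVec]
    rfl
  | m + 1, ⟨_, h⟩ =>
    refine ⟨hg, fun R hR => ?_⟩
    have := h (L * R * L⁻¹) (mul_mem (mul_mem hL hR) (inv_mem hL))
    convert this using 1
    simp [mul_assoc]

/-- A logical gate commuting up to a phase with each logical Pauli operator has the commutation
character of some logical Pauli string `Q`. Starting from the Pauli expansion of the gate,
averaging the gate with its rephased conjugate by `L` discards the strings with the wrong sign, and
some string survives. -/
theorem exists_pauliString_same_character {W : QUnitary n} (hW : S.IsLogicalGate W)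
    (χ : (Fin n → Pauli) → ℂ)
    (hχ : ∀ L, pauliElem L ∈ S.logicalPaulis → ∀ ψ ∈ S.codeSpace,
      (W : Matrix (QBasis n) (QBasis n) ℂ) *ᵥ (pauliString L *ᵥ ψ) =
        χ L • (pauliString L *ᵥ ((W : Matrix (QBasis n) (QBasis n) ℂ) *ᵥ ψ)))
    {ψ₀ : QState n} (hψ₀ : ψ₀ ∈ S.codeSpace) (hne : ψ₀ ≠ 0) :
    ∃ Q, pauliElem Q ∈ S.logicalPaulis ∧ ∀ L, pauliElem L ∈ S.logicalPaulis →
      pauliString Q * pauliString L = χ L • (pauliString L * pauliString Q) := by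
  classical
  have key : ∀ F : Finset (Fin n → Pauli), ∃ c : (Fin n → Pauli) → ℂ,
      (∀ ψ ∈ S.codeSpace, (W : Matrix (QBasis n) (QBasis n) ℂ) *ᵥ ψ =
        ∑ P, c P • (pauliString P *ᵥ ψ)) ∧
      ∀ P, c P ≠ 0 → pauliElem P ∈ S.logicalPaulis ∧
        ∀ L ∈ F, pauliElem L ∈ S.logicalPaulis →
          pauliString P * pauliString L = χ L • (pauliString L * pauliString P) := by
    intro F
    induction F using Finset.induction_on with
    | empty =>
      obtain ⟨c, hc⟩ := exists_sum_smul_pauliString (W : Matrix (QBasis n) (QBasis n) ℂ)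
      refine ⟨fun P => if pauliElem P ∈ S.logicalPaulis then c P else 0,
        fun ψ hψ => S.mulVec_eq_sum_logical hW hc hψ, fun P hP => ⟨?_, by simp⟩⟩
      by_contra h
      exact hP (if_neg h)
    | insert L F _ ih =>
      obtain ⟨c, hc, hF⟩ := ih
      by_cases hL : pauliElem L ∈ S.logicalPaulis
      swap
      · refine ⟨c, hc, fun P hP => ⟨(hF P hP).1, fun R hR hRl => ?_⟩⟩
        rcases Finset.mem_insert.mp hR with rfl | hR
        · exact absurd hRl hL
        · exact (hF P hP).2 R hR hRl
      have hconj : ∀ ψ ∈ S.codeSpace, (W : Matrix (QBasis n) (QBasis n) ℂ) *ᵥ ψ =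
          χ L • (pauliString L *ᵥ
            ((W : Matrix (QBasis n) (QBasis n) ℂ) *ᵥ (pauliString L *ᵥ ψ))) := by
        intro ψ hψ
        have := hχ L hL _ (S.isLogicalGate_of_mem hL ψ hψ)
        rw [coe_pauliElem] at this
        rw [← this, Matrix.mulVec_mulVec (M := pauliString L), pauliString_mul_self,
          Matrix.one_mulVec]
      -- `χ L` is a sign because `L` is an involution
      have hsq : χ L * χ L = 1 := by
        have h1 := hconj ψ₀ hψ₀
        rw [hχ L hL ψ₀ hψ₀, Matrix.mulVec_smul, Matrix.mulVec_mulVec, pauliString_mul_self,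
          Matrix.one_mulVec, smul_smul] at h1
        exact (smul_left_injective ℂ (mulVec_ne_zero W hne) (by simpa using h1)).symm
      choose e he hPe using fun P => pauliString_comm P L
      refine ⟨fun P => (1 + χ L * e P) / 2 * c P, fun ψ hψ => ?_, fun P hP => ?_⟩
      -- the average of `W` and `χ L • L W L` kills the strings `P` with `e P ≠ χ L`
      · have h2 : (W : Matrix (QBasis n) (QBasis n) ℂ) *ᵥ ψ =
            ∑ P, (χ L * e P * c P) • (pauliString P *ᵥ ψ) := by
          rw [hconj ψ hψ, hc (pauliString L *ᵥ ψ) (S.isLogicalGate_of_mem hL ψ hψ),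
            Matrix.mulVec_sum, Finset.smul_sum]
          refine Finset.sum_congr rfl fun P _ => ?_
          rw [Matrix.mulVec_smul, Matrix.mulVec_mulVec ψ (pauliString P),
            hPe, Matrix.smul_mulVec, Matrix.mulVec_smul, Matrix.mulVec_mulVec, ← mul_assoc,
            pauliString_mul_self, one_mul, smul_smul, smul_smul]
          congr 1
          ring
        have h3 : (W : Matrix (QBasis n) (QBasis n) ℂ) *ᵥ ψ =
            (1 / 2 : ℂ) • ((W : Matrix (QBasis n) (QBasis n) ℂ) *ᵥ ψ) +
            (1 / 2 : ℂ) • ((W : Matrix (QBasis n) (QBasis n) ℂ) *ᵥ ψ) := by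
          rw [← add_smul]; norm_num
        rw [h3]
        nth_rewrite 1 [hc ψ hψ]
        rw [h2, Finset.smul_sum, Finset.smul_sum, ← Finset.sum_add_distrib]
        refine Finset.sum_congr rfl fun P _ => ?_
        rw [smul_smul, smul_smul, ← add_smul]
        congr 1
        ring
      · obtain ⟨hP1, hP2⟩ := mul_ne_zero_iff.mp hP
        refine ⟨(hF P hP2).1, fun R hR hRl => ?_⟩
        rcases Finset.mem_insert.mp hR with rfl | hR
        · rw [hPe]
          congr 1
          rcases mul_self_eq_one_iff.mp hsq with h | h <;> rcases he P with h' | h'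
          · rw [h, h']
          · exact absurd (by rw [h, h']; norm_num) hP1
          · exact absurd (by rw [h, h']; norm_num) hP1
          · rw [h, h']
        · exact (hF P hP2).2 R hR hRl
  obtain ⟨c, hc, hF⟩ := key Finset.univ
  have : ∃ Q, c Q ≠ 0 := by
    by_contra! h
    exact mulVec_ne_zero W hne (by rw [hc ψ₀ hψ₀]; simp [h])
  obtain ⟨Q, hQ⟩ := this
  exact ⟨Q, (hF Q hQ).1, fun L hL => (hF Q hQ).2 L (Finset.mem_univ L) hL⟩

theorem inCliffordLevel_one_of_commutator {W : QUnitary n} (hW : S.IsLogicalGate W)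
    (h : ∀ L ∈ S.logicalPaulis, S.InCliffordLevel 0 ⁅W, (L : QUnitary n)⁆) :
    S.InCliffordLevel 1 W := by
  classical
  by_cases h0 : ∀ ψ ∈ S.codeSpace, ψ = 0
  · exact ⟨hW, 0, 1, one_mem _, fun ψ hψ => by simp [h0 ψ hψ]⟩
  push Not at h0
  obtain ⟨ψ₀, hψ₀, hne⟩ := h0
  have hex : ∀ L : Fin n → Pauli, ∃ x : ℂ, pauliElem L ∈ S.logicalPaulis → ∀ ψ ∈ S.codeSpace,
      (W : Matrix (QBasis n) (QBasis n) ℂ) *ᵥ (pauliString L *ᵥ ψ) =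
        x • (pauliString L *ᵥ ((W : Matrix (QBasis n) (QBasis n) ℂ) *ᵥ ψ)) := by
    intro L
    by_cases hL : pauliElem L ∈ S.logicalPaulis
    swap
    · exact ⟨0, fun h => absurd h hL⟩
    obtain ⟨-, x, hx⟩ := h _ hL
    refine ⟨x, fun _ ψ hψ => ?_⟩
    have := hx _ (S.isLogicalGate_of_mem hL _ (hW ψ hψ))
    rw [commutatorElement_def, Submonoid.coe_mul, Submonoid.coe_mul, Submonoid.coe_mul,
      ← Matrix.mulVec_mulVec, inv_mulVec_mulVec, ← Matrix.mulVec_mulVec, inv_mulVec_mulVec,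
      ← Matrix.mulVec_mulVec] at this
    exact this
  choose χ hχ using hex
  obtain ⟨Q, hQ, hQL⟩ := exists_pauliString_same_character hW χ hχ hψ₀ hne
  have hcomm : ∀ L, pauliElem L ∈ S.logicalPaulis → ∀ ψ ∈ S.codeSpace,
      (pauliString Q * (W : Matrix (QBasis n) (QBasis n) ℂ)) *ᵥ (pauliString L *ᵥ ψ) =
        pauliString L *ᵥ ((pauliString Q * (W : Matrix (QBasis n) (QBasis n) ℂ)) *ᵥ ψ) := by
    intro L hL ψ hψ
    -- the sign `χ L` occurs twice, once from `W` and once from `Q`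
    have hsq : χ L • χ L • (pauliString L * pauliString Q) = pauliString L * pauliString Q := by
      obtain ⟨e, he, hLQ⟩ := pauliString_comm Q L
      have h2 : χ L • (pauliString L * pauliString Q) = e • (pauliString L * pauliString Q) := by
        rw [← hQL L hL, hLQ]
      rw [h2, smul_comm, h2, smul_smul]
      rcases he with rfl | rfl <;> simp
    rw [← Matrix.mulVec_mulVec, hχ L hL ψ hψ, Matrix.mulVec_smul, Matrix.mulVec_mulVec, hQL L hL,
      ← Matrix.smul_mulVec, hsq, ← Matrix.mulVec_mulVec, ← Matrix.mulVec_mulVec]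
  obtain ⟨c, hc⟩ := S.exists_scalar_of_commute hcomm fun ψ hψ => by
    rw [← Matrix.mulVec_mulVec]
    exact S.isLogicalGate_of_mem hQ _ (hW ψ hψ)
  refine ⟨hW, c, pauliElem Q, hQ, fun ψ hψ => ?_⟩
  rw [coe_pauliElem, ← Matrix.mulVec_smul, ← hc ψ hψ, Matrix.mulVec_mulVec, ← mul_assoc,
    pauliString_mul_self, one_mul]

/-- Uses `U L U⁻¹ = ⁅U, L⁆ L`, each level above the zeroth being stable under multiplication by
logical Pauli operators. -/
theorem inCliffordLevel_succ_of_commutator {m : ℕ} {U : QUnitary n} (hU : S.IsLogicalGate U)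
    (h : ∀ L ∈ S.logicalPaulis, S.InCliffordLevel m ⁅U, (L : QUnitary n)⁆) :
    S.InCliffordLevel (m + 1) U := by
  match m, h with
  | 0, h => exact inCliffordLevel_one_of_commutator hU h
  | m + 1, h =>
    refine ⟨hU, fun L hL => ?_⟩
    have := (h L hL).mul_logicalPauli hL
    rwa [commutatorElement_def, inv_mul_cancel_right] at this

end StabilizerCode

/-- The iterated commutator `⁅⋯⁅⁅U, L 0⁆, L 1⁆⋯, L (m - 1)⁆`. -/
def iteratedCommutator {G : Type*} [Group G] : (m : ℕ) → G → (Fin m → G) → G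
  | 0, U, _ => U
  | m + 1, U, L => iteratedCommutator m ⁅U, L 0⁆ (Fin.tail L)

namespace StabilizerCode

variable {n : ℕ} {S : StabilizerCode n}

theorem IsLogicalGate.iteratedCommutator {m : ℕ} {U : QUnitary n} (hU : S.IsLogicalGate U)
    {L : Fin m → QUnitary n} (hL : ∀ i, S.IsLogicalGate (L i)) :
    S.IsLogicalGate (iteratedCommutator m U L) := by
  induction m generalizing U with
  | zero => exact hU
  | succ m ih => exact ih (hU.commutator (hL 0)) fun i => hL i.succ

theorem SameAction.iteratedCommutator {m : ℕ} {U V : QUnitary n} (hU : S.SameAction U V)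
    {L R : Fin m → QUnitary n} (hL : ∀ i, S.SameAction (L i) (R i)) :
    S.SameAction (iteratedCommutator m U L) (iteratedCommutator m V R) := by
  induction m generalizing U V with
  | zero => exact hU
  | succ m ih => exact ih (hU.commutator (hL 0)) fun i => hL i.succ

theorem inCliffordLevel_of_iteratedCommutator {m : ℕ} {U : QUnitary n} (hU : S.IsLogicalGate U)
    (h : ∀ L : Fin m → S.logicalPaulis,
      S.InCliffordLevel 0 (iteratedCommutator m U fun i => ((L i : pauliGroup n) : QUnitary n))) :
    S.InCliffordLevel m U := by
  induction m generalizing U with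
  | zero => exact h Fin.elim0
  | succ m ih =>
    refine inCliffordLevel_succ_of_commutator hU fun L hL =>
      ih (hU.commutator (S.isLogicalGate_of_mem hL)) fun R => ?_
    simpa [iteratedCommutator, Fin.tail_def] using h (Fin.cons ⟨L, hL⟩ R)

end StabilizerCode

/-! ### Transversal gates of small support -/

section Transversal

variable {n : ℕ}

/-- `V` is a tensor product of single-qubit unitaries that are the identity outside `T`. -/
def IsTransversalOn (T : Set (Fin n)) (V : QUnitary n) : Prop :=
  ∃ A : Fin n → Matrix.unitaryGroup (Fin 2) ℂ,
    (V : Matrix (QBasis n) (QBasis n) ℂ) =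
      tensorMat (fun j => (A j : Matrix (Fin 2) (Fin 2) ℂ)) ∧ ∀ j ∉ T, A j = 1

theorem coe_inv_eq_tensorMat {V : QUnitary n} {A : Fin n → Matrix.unitaryGroup (Fin 2) ℂ}
    (h : (V : Matrix (QBasis n) (QBasis n) ℂ) =
      tensorMat (fun j => (A j : Matrix (Fin 2) (Fin 2) ℂ))) :
    ((V⁻¹ : QUnitary n) : Matrix (QBasis n) (QBasis n) ℂ) =
      tensorMat (fun j => ((A j)⁻¹ : Matrix.unitaryGroup (Fin 2) ℂ)) := by
  rw [Matrix.UnitaryGroup.inv_val, h]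
  ext x y
  simp [tensorMat, Matrix.star_apply]

/-- The commutator of a transversal gate with a Pauli operator is transversal, and supported on
the common support: on each other qubit one of the two factors is the identity, and the phase of
the Pauli operator cancels. -/
theorem IsTransversalOn.commutator {T : Set (Fin n)} {V : QUnitary n} (hV : IsTransversalOn T V)
    (L : pauliGroup n) : IsTransversalOn (T ∩ pauliSupport L) ⁅V, (L : QUnitary n)⁆ := by
  obtain ⟨A, hA, hT⟩ := hV
  obtain ⟨k, P, hP⟩ := L.2
  let B : Fin n → Matrix.unitaryGroup (Fin 2) ℂ := fun j => ⟨(P j).mat, by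
    rw [Matrix.mem_unitaryGroup_iff, Matrix.star_eq_conjTranspose, Pauli.mat_star,
      Pauli.mat_mul_self]⟩
  have hphase : ⁅V, (L : QUnitary n)⁆ = ⁅V, (pauliElem P : QUnitary n)⁆ := by
    apply Subtype.ext
    simp only [commutatorElement_def, Submonoid.coe_mul, Matrix.UnitaryGroup.inv_val, hP,
      coe_pauliElem, star_smul, Matrix.smul_mul, Matrix.mul_smul, smul_smul]
    rw [star_pow, ← mul_pow]
    simp
  have hB : ((pauliElem P : QUnitary n) : Matrix (QBasis n) (QBasis n) ℂ) =
      tensorMat (fun j => (B j : Matrix (Fin 2) (Fin 2) ℂ)) := rfl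
  refine ⟨fun j => ⁅A j, B j⁆, ?_, fun j hj => ?_⟩
  · rw [hphase]
    simp only [commutatorElement_def, Submonoid.coe_mul, coe_inv_eq_tensorMat hA,
      coe_inv_eq_tensorMat hB, hA, hB, tensorMat_mul]
  · by_cases hjT : j ∈ T
    · have hPj : P j = .I := by
        by_contra hne
        exact hj ⟨hjT, k, P, hP, hne⟩
      have : B j = 1 := Subtype.ext (by simp [B, hPj, Pauli.mat])
      simp [this]
    · simp [hT j hjT]

theorem IsTransversalOn.iteratedCommutator {m : ℕ} {T : Set (Fin n)} {V : QUnitary n}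
    (hV : IsTransversalOn T V) (L : Fin m → pauliGroup n) :
    IsTransversalOn (T ∩ ⋂ i, pauliSupport (L i))
      (iteratedCommutator m V fun i => (L i : QUnitary n)) := by
  induction m generalizing V T with
  | zero => simpa [_root_.iteratedCommutator] using hV
  | succ m ih =>
    have := ih (hV.commutator (L 0)) (Fin.tail L)
    have hset : (⋂ i, pauliSupport (L i)) =
        pauliSupport (L 0) ∩ ⋂ i, pauliSupport (Fin.tail L i) := by
      ext j
      simp [Fin.forall_fin_succ, Fin.tail]
    rwa [hset, ← Set.inter_assoc]

theorem IsTransversalOn.exists_sum_smul_pauliString {T : Set (Fin n)} {V : QUnitary n}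
    (hV : IsTransversalOn T V) : ∃ c : (Fin n → Pauli) → ℂ,
      (V : Matrix (QBasis n) (QBasis n) ℂ) = ∑ P, c P • pauliString P ∧
        ∀ P, c P ≠ 0 → ∀ j ∉ T, P j = .I := by
  obtain ⟨A, hA, hT⟩ := hV
  have : ∀ j, ∃ a : Pauli → ℂ, (A j : Matrix (Fin 2) (Fin 2) ℂ) = ∑ p, a p • p.mat ∧
      (j ∉ T → ∀ p, p ≠ .I → a p = 0) := by
    intro j
    by_cases hj : j ∈ T
    · obtain ⟨a, ha⟩ := Pauli.exists_sum_smul_mat (A j : Matrix (Fin 2) (Fin 2) ℂ)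
      exact ⟨a, ha, fun h => absurd hj h⟩
    · refine ⟨fun p => match p with | .I => 1 | _ => 0, ?_, fun _ p hp => ?_⟩
      · rw [hT j hj, Pauli.sum_eq]
        simp [Pauli.mat]
      · cases p <;> simp_all
  choose a ha ha0 using this
  refine ⟨fun P => ∏ j, a j (P j), ?_, fun P hP j hj => ?_⟩
  · rw [hA, ← tensorMat_sum_smul]
    simp only [ha]
  · by_contra h
    exact Finset.prod_ne_zero_iff.mp hP j (Finset.mem_univ j) (ha0 j hj _ h)

end Transversal

namespace StabilizerCode

variable {n : ℕ} {S : StabilizerCode n}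

theorem equivalent_one_of_encard_lt {L : pauliGroup n} (hL : L ∈ S.logicalPaulis)
    (h : (pauliSupport L).encard < S.minDistance) : S.Equivalent 1 L := by
  by_contra hne
  have hrefl : S.Equivalent L L := ⟨1, 1, one_mem _, by simp⟩
  exact absurd h (not_lt.mpr ((iInf₂_le L ⟨hL, hne⟩).trans (iInf₂_le L hrefl)))

/-- A logical gate supported on fewer qubits than the min-distance is a phase on the code space,
since the logical strings in its Pauli expansion are all trivial. -/
theorem inCliffordLevel_zero_of_encard_lt {T : Set (Fin n)} {V : QUnitary n}
    (hV : S.IsLogicalGate V) (hVT : IsTransversalOn T V) (hT : T.encard < S.minDistance) :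
    S.InCliffordLevel 0 V := by
  classical
  obtain ⟨c, hc, hsupp⟩ := hVT.exists_sum_smul_pauliString
  have : ∀ P, ∃ x : ℂ, ∀ ψ ∈ S.codeSpace,
      (if pauliElem P ∈ S.logicalPaulis then c P else 0) • (pauliString P *ᵥ ψ) = x • ψ := by
    intro P
    by_cases hP : pauliElem P ∈ S.logicalPaulis
    swap
    · exact ⟨0, fun ψ _ => by simp [hP]⟩
    by_cases hcP : c P = 0
    · exact ⟨0, fun ψ _ => by simp [hcP]⟩
    obtain ⟨d, s, hs, h⟩ := equivalent_one_of_encard_lt hP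
      ((Set.encard_le_encard (pauliSupport_pauliElem_subset (hsupp P hcP))).trans_lt hT)
    refine ⟨c P * d, fun ψ hψ => ?_⟩
    rw [if_pos hP, ← coe_pauliElem, h, one_mul, Matrix.smul_mulVec, hψ s hs, smul_smul]
  choose x hx using this
  refine ⟨hV, ∑ P, x P, fun ψ hψ => ?_⟩
  rw [S.mulVec_eq_sum_logical hV hc hψ, Finset.sum_smul]
  exact Finset.sum_congr rfl fun P _ => hx P ψ hψ

end StabilizerCode

theorem theorem3 (n : ℕ) (S : StabilizerCode n) (M : ℕ) (hM : 0 < M)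
    (hΩ : S.Omega M < S.minDistance)
    (U : QUnitary n) (hU : S.IsLogicalGate U) (hT : IsTransversal U) :
    S.InCliffordLevel M U := by
  refine StabilizerCode.inCliffordLevel_of_iteratedCommutator hU fun L => ?_
  obtain ⟨R, hR, hlt⟩ : ∃ R ∈ {R : Fin M → pauliGroup n | ∀ i, S.Equivalent (L i) (R i)},
      (⋂ i, pauliSupport (R i)).encard < S.minDistance := by
    have := (le_iSup (fun L : Fin M → S.logicalPaulis =>
      ⨅ R ∈ {R : Fin M → pauliGroup n | ∀ i, S.Equivalent (L i) (R i)},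
        (⋂ i, pauliSupport (R i)).encard) L).trans_lt hΩ
    simpa only [iInf_lt_iff, exists_prop] using this
  have hLR := fun i => (hR i).sameAction (L i).2
  have hUT : IsTransversalOn Set.univ U := by
    obtain ⟨A, hA⟩ := hT
    exact ⟨A, hA, by simp⟩
  refine ((StabilizerCode.SameAction.refl hU).iteratedCommutator hLR).inCliffordLevel_zero
    (StabilizerCode.inCliffordLevel_zero_of_encard_lt
      (hU.iteratedCommutator fun i => (hLR i).2.1) (hUT.iteratedCommutator R) ?_)
  rwa [Set.univ_inter]
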